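/- Let $q>2$, let $0<h<1$ with $2/h\notin\mathbb Z$, put $\ell^*=\lceil 2/h\rceil$, and let $K,L$ be integers with $\min\{K,L\}\ge 3\ell^*$. Let $\Lambda=(V,E)$ be the $K\times L$ square lattice with nearest-neighbour edges and periodic boundary conditions, and on $\mathcal X=\{1,\dots,q\}^V$ consider the Hamiltonian of the $q$-state Potts model with negative external field $$H(\sigma)=-\sum_{(v,w)\in E}\mathbb 1_{\{\sigma(v)=\sigma(w)\}}+h\sum_{u\in V}\mathbb 1_{\{\sigma(u)=1\}}$$ and the connectivity matrix $Q$ of single-spin updates: for $\sigma\neq\sigma'$, $Q(\sigma,\sigma')=\frac1{q|V|}$ if $\sigma,\sigma'$ differ at exactly one vertex and $Q(\sigma,\sigma')=0$ otherwise. Let $\mathcal X^s$ be the set of global minimizers of $H$ (the stable states) and let $\mathbf 1$ be the configuration with all spins equal to $1$. A path is a finite sequence of configurations whose consecutive members satisfy $Q>0$; put $\Phi(\sigma,\sigma')=\min_{\omega:\sigma\to\sigma'}\max_{\eta\in\omega}H(\eta)$, the minimum being over the paths from $\sigma$ to $\sigma'$, $\Phi(\sigma,\mathcal A)=\min_{\sigma'\in\mathcal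 A}\Phi(\sigma,\sigma')$ and $\Gamma(\sigma,\mathcal A)=\Phi(\sigma,\mathcal A)-H(\sigma)$ for nonempty $\mathcal A\subset\mathcal X$. Let $\partial\mathcal C$ be the set of $\eta\notin\mathcal C$ with $Q(\sigma,\eta)>0$ for some $\sigma\in\mathcal C$. A cycle is a nonempty $\mathcal C\subset\mathcal X$ that is either a singleton, or is connected (any two of its elements are joined by a path contained in $\mathcal C$) with $\max_{\mathcal C}H<\min_{\partial\mathcal C}H$; its depth is $0$ if $\mathcal C$ is a singleton and $\min_{\partial\mathcal C}H-\min_{\mathcal C}H$ otherwise. For $\mathcal A\subset\mathcal X$ let $\widetilde\Gamma(\mathcal A)$ be the maximum of the depths of the cycles contained in $\mathcal A$ that are maximal by inclusion among the cycles contained in $\mathcal A$. Then for every $\mathbf s\in\mathcal X^s$: 1. $\Phi(\mathbf 1,\mathcal X^s)>\Phi(\mathbf s,\mathcal X^s\setminus\{\mathbf s\})$; 2. $\Gamma(\mathbf 1,\mathcal X^s)<\Gamma(\mathbf s,\mathcal X^s\setminus\{\mathbf s\})$, where $\Gamma(\mathbf s,\mathcal X^s\setminus\{\mathbf s\})=2\min\{K,L\}+2$;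 3. $\widetilde\Gamma(\mathcal X\setminus\{\mathbf s\})=\Gamma(\mathbf r,\mathcal X^s\setminus\{\mathbf r\})$ for every $\mathbf r\in\mathcal X^s$. -/

import Mathlib

/-- An energy landscape on a state space `X`: an energy function `H` and a connectivity
matrix `Q`.  (Only used below for the concrete landscape `pottsNeg`.) -/
structure EnergyLandscape (X : Type) where
  /-- the Hamiltonian -/
  H : X → ℝ
  /-- the connectivity matrix -/
  Q : X → X → ℝ

namespace EnergyLandscape

variable {X : Type} (𝓔 : EnergyLandscape X)

/-- A path `ω : σ → σ'`, i.e. a finite sequence `ω₀, …, ωₙ` of states with `ω₀ = σ`, `ωₙ = σ'`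
and `Q (ωᵢ, ωᵢ₊₁) > 0` for all `i < n`. -/
structure Path (σ σ' : X) where
  length : ℕ
  toFun : Fin (length + 1) → X
  source : toFun 0 = σ
  target : toFun (Fin.last length) = σ'
  step : ∀ i : Fin length, 0 < 𝓔.Q (toFun i.castSucc) (toFun i.succ)

/-- The height `Φ_ω = maxᵢ H (ωᵢ)` of a path. -/
noncomputable def Path.height {𝓔 : EnergyLandscape X} {σ σ' : X} (ω : 𝓔.Path σ σ') : ℝ :=
  Finset.univ.sup' Finset.univ_nonempty (fun i => 𝓔.H (ω.toFun i))

/-- The communication height `Φ(σ, σ')`: the minimum of the heights of the paths `σ → σ'`.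
(On a finite irreducible landscape there are paths and their heights take finitely many values,
so that the infimum is a minimum.) -/
noncomputable def commHeight (σ σ' : X) : ℝ :=
  sInf (Set.range fun ω : 𝓔.Path σ σ' => ω.height)

/-- The communication height between sets, `Φ(A, B) = min_{σ ∈ A, σ' ∈ B} Φ(σ, σ')`. -/
noncomputable def commHeightSet (A B : Set X) : ℝ :=
  sInf {x : ℝ | ∃ σ ∈ A, ∃ σ' ∈ B, x = 𝓔.commHeight σ σ'}

/-- The energy barrier `Γ(σ, A) = Φ(σ, A) - H(σ)`. -/
noncomputable def barrier (σ : X) (A : Set X) : ℝ :=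
  𝓔.commHeightSet {σ} A - 𝓔.H σ

/-- The bottom of `A`: the set of the minimizers of `H` in `A`. -/
def bottom (A : Set X) : Set X := {η ∈ A | ∀ σ ∈ A, 𝓔.H η ≤ 𝓔.H σ}

/-- The set `X^s` of the stable states. -/
def stable : Set X := 𝓔.bottom Set.univ

/-- The common value of `H` on the bottom of a (finite, nonempty) set `A`. -/
noncomputable def minEnergy (A : Set X) : ℝ := sInf (𝓔.H '' A)

/-- The external boundary of `A`: the states outside `A` that can be reached from `A` in one step.
(For `σ ≠ η` the Metropolis transition probability `P(σ, η)` is positive exactly when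
`Q(σ, η)` is.) -/
def boundary (A : Set X) : Set X := {η | η ∉ A ∧ ∃ σ ∈ A, 0 < 𝓔.Q σ η}

/-- `A` is connected: any two states of `A` are joined by a path contained in `A`. -/
def IsConnectedSet (A : Set X) : Prop :=
  ∀ σ ∈ A, ∀ η ∈ A, ∃ ω : 𝓔.Path σ η, ∀ i, ω.toFun i ∈ A

/-- A trivial cycle is a singleton. -/
def IsTrivialCycle (C : Set X) : Prop := ∃ σ, C = {σ}

/-- A cycle: a nonempty set that is a singleton, or is connected and satisfies
`max_C H < min_{∂C} H`. -/
def IsCycle (C : Set X) : Prop :=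
  C.Nonempty ∧ (IsTrivialCycle C ∨
    (𝓔.IsConnectedSet C ∧ ∀ σ ∈ C, ∀ η ∈ 𝓔.boundary C, 𝓔.H σ < 𝓔.H η))

open scoped Classical in
/-- The depth of a cycle: `min_{∂C} H - min_C H`, and `0` for a trivial cycle. -/
noncomputable def depth (C : Set X) : ℝ :=
  if IsTrivialCycle C then 0 else 𝓔.minEnergy (𝓔.boundary C) - 𝓔.minEnergy C

/-- The collection of the maximal cycles contained in `A`. -/
def maximalCycles (A : Set X) : Set (Set X) :=
  {C | Maximal (fun D => 𝓔.IsCycle D ∧ D ⊆ A) C}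

/-- The maximum depth of `A`, i.e. the maximum of the depths of the maximal cycles in `A`
(a maximum of finitely many values when `X` is finite). -/
noncomputable def maxDepth (A : Set X) : ℝ := sSup (𝓔.depth '' 𝓔.maximalCycles A)

end EnergyLandscape

namespace Potts

/-- The set `{1, …, q}` of spin values. -/
abbrev Spin (q : ℕ) : Type := ↥(Finset.Icc 1 q)

/-- The vertices of the `K × L` lattice. -/
abbrev Vertex (K L : ℕ) : Type := Fin K × Fin L

/-- Spin configurations. -/
abbrev Config (K L q : ℕ) : Type := Vertex K L → Spin q

/-- The `K × L` lattice with periodic boundary conditions (nearest-neighbour edges), as the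
Cartesian product of two cycles. -/
def torus (K L : ℕ) : SimpleGraph (Vertex K L) :=
  SimpleGraph.boxProd (SimpleGraph.cycleGraph K) (SimpleGraph.cycleGraph L)

open scoped Classical in
/-- The Hamiltonian with negative external field,
`H(σ) = - ∑_{(v,w) ∈ E} 1{σ(v) = σ(w)} + h ∑_{u ∈ V} 1{σ(u) = 1}`.
Edges are unordered pairs; an edge is counted when `σ` is constant on its endpoints. -/
noncomputable def energyNeg (K L q : ℕ) (h : ℝ) (σ : Config K L q) : ℝ :=
  -(∑ e ∈ (torus K L).edgeFinset, if (∀ v ∈ e, ∀ w ∈ e, σ v = σ w) then (1 : ℝ) else 0)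
    + h * ∑ u : Vertex K L, if (σ u : ℕ) = 1 then (1 : ℝ) else 0

/-- The number of vertices at which two configurations differ. -/
def numDiff {K L q : ℕ} (σ σ' : Config K L q) : ℕ :=
  (Finset.univ.filter fun v => σ v ≠ σ' v).card

/-- The connectivity matrix of the single-spin-flip dynamics: `1 / (q |V|)` for configurations that
differ at exactly one vertex, `0` if they differ at more than one.  The diagonal entry `1 / q`
makes the rows sum to one; it does not influence communication heights or cycles. -/
noncomputable def connectivity (K L q : ℕ) (σ σ' : Config K L q) : ℝ :=
  if numDiff σ σ' = 1 then 1 / ((q : ℝ) * Fintype.card (Vertex K L))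
  else if numDiff σ σ' = 0 then 1 / (q : ℝ)
  else 0

/-- The energy landscape of the `q`-state Potts model on the `K × L` torus with negative
external field. -/
noncomputable def pottsNeg (K L q : ℕ) (h : ℝ) : EnergyLandscape (Config K L q) where
  H := energyNeg K L q h
  Q := connectivity K L q

/-- The configuration in which all the spins are `1`. -/
def allOne (K L q : ℕ) (hq : 2 < q) : Config K L q :=
  fun _ => ⟨1, Finset.mem_Icc.mpr ⟨le_refl 1, by omega⟩⟩

/-- The critical length `ℓ* = ⌈2 / h⌉`. -/
noncomputable def criticalLength (h : ℝ) : ℕ := ⌈2 / h⌉₊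

end Potts

/-! Up to the constant `-2KL`, the energy is the number of disagreeing neighbour pairs plus `h`
times the number of ones. The stable states are therefore the constants with spin other than `1`.
Write `Γ = 2 min{K, L} + 2`. Upper bound (`exists_path_height_le`): recolouring line by line along
the shorter side with `c ≠ 1` adds at most the perimeter of the recoloured region, which is at most
`Γ`, and creates no ones. Hence every state reaches every stable state with barrier at most `Γ`.
Lower bound (`le_gridChanges_of_update`): on the way to the constant `d`, some update creates the
second line of colour `d`. Just before or just after it there are at least `Γ` disagreements.
Together these give the barrier between stable states. They also give the maximal depth off `s`: no
cycle missing `s` is deeper than `Γ`, and the basin of another stable state has that depth. From all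
ones the same sweep also loses ones, so its barrier is strictly below `Γ`. The energy of all ones,
with excess `hKL ≥ 6 min{K, L} > Γ`, already exceeds the height between stable states. -/

namespace EnergyLandscape

/-! ### Paths, communication heights and cycle depths in a general landscape -/

variable {X : Type} {𝓔 : EnergyLandscape X}

theorem Path.le_height {σ σ' : X} (ω : 𝓔.Path σ σ') (i : Fin (ω.length + 1)) :
    𝓔.H (ω.toFun i) ≤ ω.height :=
  Finset.le_sup' (fun i => 𝓔.H (ω.toFun i)) (Finset.mem_univ i)

theorem Path.height_le_iff {σ σ' : X} {ω : 𝓔.Path σ σ'} {a : ℝ} :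
    ω.height ≤ a ↔ ∀ i, 𝓔.H (ω.toFun i) ≤ a := by
  simp [Path.height]

theorem Path.height_lt_iff {σ σ' : X} {ω : 𝓔.Path σ σ'} {a : ℝ} :
    ω.height < a ↔ ∀ i, 𝓔.H (ω.toFun i) < a := by
  simp [Path.height]

theorem Path.source_le_height {σ σ' : X} (ω : 𝓔.Path σ σ') : 𝓔.H σ ≤ ω.height := by
  simpa [ω.source] using ω.le_height 0

/-- A path that starts inside `P` and ends outside `P` has a step leaving `P`. -/
theorem Path.exists_crossing {σ σ' : X} (ω : 𝓔.Path σ σ') (P : X → Prop) (h0 : P σ)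
    (h1 : ¬ P σ') : ∃ i : Fin ω.length, P (ω.toFun i.castSucc) ∧ ¬ P (ω.toFun i.succ) := by
  by_contra! hcon
  have key : ∀ i, P (ω.toFun i) := by
    intro i
    induction i using Fin.induction with
    | zero => rw [ω.source]; exact h0
    | succ i ih => exact hcon i ih
  exact h1 (ω.target ▸ key _)

/-- A path that starts inside `C` and ends outside `C` visits the boundary of `C`. -/
theorem Path.exists_mem_boundary {σ σ' : X} (ω : 𝓔.Path σ σ') {C : Set X} (h0 : σ ∈ C)
    (h1 : σ' ∉ C) : ∃ i, ω.toFun i ∈ 𝓔.boundary C := by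
  obtain ⟨i, hi, hi'⟩ := ω.exists_crossing (· ∈ C) h0 h1
  exact ⟨i.succ, hi', _, hi, ω.step i⟩

/-- The trivial path. -/
def Path.refl (σ : X) : 𝓔.Path σ σ where
  length := 0
  toFun _ := σ
  source := rfl
  target := rfl
  step i := i.elim0

/-- A path prolonged by one step. -/
def Path.snoc {σ σ' σ'' : X} (ω : 𝓔.Path σ σ') (h : 0 < 𝓔.Q σ' σ'') : 𝓔.Path σ σ'' where
  length := ω.length + 1
  toFun := Fin.snoc (α := fun _ => X) ω.toFun σ''
  source := by
    have : (0 : Fin (ω.length + 1 + 1)) = Fin.castSucc 0 := rfl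
    rw [this, Fin.snoc_castSucc, ω.source]
  target := by simp
  step i := by
    induction i using Fin.lastCases with
    | last => simpa [ω.target] using h
    | cast i =>
      rw [Fin.snoc_castSucc, Fin.succ_castSucc, Fin.snoc_castSucc]
      exact ω.step i

theorem exists_path_of_reflTransGen {A : Set X} {σ σ' : X} (hσ : σ ∈ A)
    (h : Relation.ReflTransGen (fun a b => 0 < 𝓔.Q a b ∧ b ∈ A) σ σ') :
    ∃ ω : 𝓔.Path σ σ', ∀ i, ω.toFun i ∈ A := by
  induction h with
  | refl => exact ⟨Path.refl σ, fun _ => hσ⟩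
  | tail _ hbc ih =>
    obtain ⟨ω, hω⟩ := ih
    refine ⟨ω.snoc hbc.1, fun i => ?_⟩
    change Fin.snoc (α := fun _ => X) ω.toFun _ i ∈ A
    induction i using Fin.lastCases with
    | last => exact (Fin.snoc_last (α := fun _ => X) _ ω.toFun).symm ▸ hbc.2
    | cast i => exact (Fin.snoc_castSucc (α := fun _ => X) _ ω.toFun i).symm ▸ hω i

theorem commHeight_le_height {σ σ' : X} (ω : 𝓔.Path σ σ') : 𝓔.commHeight σ σ' ≤ ω.height :=
  csInf_le ⟨𝓔.H σ, by rintro _ ⟨ω, rfl⟩; exact ω.source_le_height⟩ ⟨ω, rfl⟩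

/-- A path must exist, since an infimum over no paths would be `sInf ∅ = 0`. -/
theorem le_commHeight {σ σ' : X} {a : ℝ} (hne : Nonempty (𝓔.Path σ σ'))
    (h : ∀ ω : 𝓔.Path σ σ', a ≤ ω.height) : a ≤ 𝓔.commHeight σ σ' :=
  le_csInf (Set.range_nonempty _) (by rintro _ ⟨ω, rfl⟩; exact h ω)

theorem commHeightSet_singleton_le [Finite X] {σ σ' : X} {A : Set X} (h : σ' ∈ A) :
    𝓔.commHeightSet {σ} A ≤ 𝓔.commHeight σ σ' := by
  refine csInf_le (Set.Finite.bddBelow ?_) ⟨σ, rfl, σ', h, rfl⟩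
  refine (Set.toFinite (Set.range fun p : X × X => 𝓔.commHeight p.1 p.2)).subset ?_
  rintro _ ⟨a, _, b, _, rfl⟩
  exact ⟨(a, b), rfl⟩

theorem le_commHeightSet_singleton {σ : X} {A : Set X} {a : ℝ} (hA : A.Nonempty)
    (h : ∀ σ' ∈ A, a ≤ 𝓔.commHeight σ σ') : a ≤ 𝓔.commHeightSet {σ} A := by
  obtain ⟨b, hb⟩ := hA
  refine le_csInf ⟨_, σ, rfl, b, hb, rfl⟩ ?_
  rintro _ ⟨_, rfl, σ', hσ', rfl⟩
  exact h σ' hσ'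

theorem minEnergy_le [Finite X] {A : Set X} {η : X} (h : η ∈ A) : 𝓔.minEnergy A ≤ 𝓔.H η :=
  csInf_le (Set.toFinite _).bddBelow ⟨η, h, rfl⟩

theorem le_minEnergy {A : Set X} {a : ℝ} (hA : A.Nonempty) (h : ∀ η ∈ A, a ≤ 𝓔.H η) :
    a ≤ 𝓔.minEnergy A :=
  le_csInf (hA.image _) (by rintro _ ⟨η, hη, rfl⟩; exact h η hη)

/-- If `s` can be reached from everywhere with barrier at most `Γ`, a cycle missing `s` has depth
at most `Γ`. -/
theorem depth_le [Finite X] {s : X} {Γ : ℝ} (hΓ : 0 ≤ Γ)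
    (hs : ∀ η, ∃ ω : 𝓔.Path η s, ω.height ≤ 𝓔.H η + Γ) {C : Set X} (hC : C.Nonempty)
    (hsC : s ∉ C) : 𝓔.depth C ≤ Γ := by
  unfold depth
  split_ifs
  · exact hΓ
  -- The path from a minimizer of `C` to `s` leaves `C` through its boundary, at height at most
  -- `min_C H + Γ`.
  · obtain ⟨η, hη, hmin⟩ := Set.exists_min_image C 𝓔.H (Set.toFinite C) hC
    obtain ⟨ω, hω⟩ := hs η
    obtain ⟨i, hi⟩ := ω.exists_mem_boundary hη hsC
    have h1 := minEnergy_le (𝓔 := 𝓔) hi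
    have h2 := ω.le_height i
    have h3 := le_minEnergy hC hmin
    linarith

/-- The basin of `r` below an energy level that has to be reached on the way to `s` is contained
in a maximal cycle of the complement of `s`, whose depth is at least the height of that level. -/
theorem exists_maximalCycle_le_depth [Finite X] (hsymm : ∀ a b, 0 < 𝓔.Q a b → 0 < 𝓔.Q b a)
    {r s η : X} {Γ : ℝ} (hr : ∀ σ, 𝓔.H r ≤ 𝓔.H σ) (hne : Nonempty (𝓔.Path r s))
    (hrs : ∀ ω : 𝓔.Path r s, 𝓔.H r + Γ ≤ ω.height)
    (hη : η ≠ r) (hQ : 0 < 𝓔.Q r η) (hHη : 𝓔.H η < 𝓔.H r + Γ) :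
    ∃ C ∈ 𝓔.maximalCycles (Set.univ \ {s}), Γ ≤ 𝓔.depth C := by
  set A : Set X := {σ | 𝓔.H σ < 𝓔.H r + Γ} with hA
  have hrA : r ∈ A := lt_of_le_of_lt (hr η) hHη
  -- `B` is the component of `r` in the open sublevel set `A`.
  set B : Set X := {σ | Relation.ReflTransGen (fun a b => 0 < 𝓔.Q a b ∧ b ∈ A) r σ} with hB
  have hrB : r ∈ B := Relation.ReflTransGen.refl
  have hBA : B ⊆ A := by
    intro σ hσ
    rcases Relation.ReflTransGen.cases_tail hσ with h | ⟨_, _, h⟩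
    · exact h ▸ hrA
    · exact h.2
  have hclosed : ∀ a ∈ B, ∀ b ∈ A, 0 < 𝓔.Q a b → b ∈ B := fun a ha b hb hab =>
    Relation.ReflTransGen.tail ha ⟨hab, hb⟩
  have hηB : η ∈ B := hclosed r hrB η hHη hQ
  have hsB : s ∉ B := by
    intro hs
    obtain ⟨ω, hω⟩ := exists_path_of_reflTransGen hrA hs
    exact absurd (hrs ω) (not_le.mpr (Path.height_lt_iff.mpr hω))
  have hfrom : ∀ σ ∈ B, Relation.ReflTransGen (fun a b => 0 < 𝓔.Q a b ∧ b ∈ B) r σ := by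
    intro σ hσ
    induction hσ with
    | refl => exact .refl
    | tail hab hbc ih => exact ih.tail ⟨hbc.1, hclosed _ hab _ hbc.2 hbc.1⟩
  have hto : ∀ σ ∈ B, Relation.ReflTransGen (fun a b => 0 < 𝓔.Q a b ∧ b ∈ B) σ r := by
    intro σ hσ
    induction hσ with
    | refl => exact .refl
    | tail hab hbc ih => exact (ih).head ⟨hsymm _ _ hbc.1, hab⟩
  have hBcycle : 𝓔.IsCycle B := by
    refine ⟨⟨r, hrB⟩, Or.inr ⟨fun σ hσ σ' hσ' =>
      exists_path_of_reflTransGen hσ ((hto σ hσ).trans (hfrom σ' hσ')), ?_⟩⟩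
    rintro σ hσ σ' ⟨hσ', a, ha, haσ'⟩
    have h1 : 𝓔.H σ < _ := hBA hσ
    have h2 : ¬ 𝓔.H σ' < _ := fun h => hσ' (hclosed a ha σ' h haσ')
    linarith
  obtain ⟨C, hBC, hC⟩ := (Set.toFinite {D : Set X | 𝓔.IsCycle D ∧ D ⊆ Set.univ \ {s}}).exists_le_maximal
    (show B ∈ _ from ⟨hBcycle, fun σ hσ => ⟨trivial, fun h => hsB (h ▸ hσ)⟩⟩)
  -- The neighbour `η` serves only here: a singleton would have depth `0` by convention.
  have hntriv : ¬ IsTrivialCycle C := by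
    rintro ⟨σ, rfl⟩
    exact hη ((hBC hηB).trans (hBC hrB).symm)
  have hsC : s ∉ C := fun h => (hC.prop.2 h).2 rfl
  refine ⟨C, hC, ?_⟩
  have hlt := (hC.prop.1.2.resolve_left hntriv).2
  have hconn := (hC.prop.1.2.resolve_left hntriv).1
  -- A boundary state below the level would put all of `C` below it too. Then connectedness gives `C
  -- ⊆ B`, and closedness of `B` in `A` puts that state in `B ⊆ C`.
  have hbdry : ∀ σ ∈ 𝓔.boundary C, 𝓔.H r + Γ ≤ 𝓔.H σ := by
    intro σ hσ
    by_contra! hcon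
    obtain ⟨a, haC, haσ⟩ := hσ.2
    have hCB : C ⊆ B := by
      intro b hb
      by_contra hbB
      obtain ⟨ω, hω⟩ := hconn r (hBC hrB) b hb
      obtain ⟨i, hi, c, hc, hci⟩ := ω.exists_mem_boundary hrB hbB
      exact hi (hclosed c hc _ ((hlt _ (hω i) σ hσ).trans hcon) hci)
    exact hσ.1 (hBC (hclosed a (hCB haC) σ hcon haσ))
  -- This makes the boundary nonempty, so its minimal energy is not the default `sInf ∅`.
  obtain ⟨ω⟩ := hne
  obtain ⟨i, hi⟩ := ω.exists_mem_boundary (hBC hrB) hsC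
  have h1 := le_minEnergy ⟨_, hi⟩ hbdry
  have h2 := minEnergy_le (𝓔 := 𝓔) (hBC hrB : r ∈ C)
  rw [depth, if_neg hntriv]
  linarith

theorem maxDepth_compl_singleton_eq [Finite X] (hsymm : ∀ a b, 0 < 𝓔.Q a b → 0 < 𝓔.Q b a)
    {r s η : X} {Γ : ℝ} (hΓ : 0 ≤ Γ) (hs : ∀ η, ∃ ω : 𝓔.Path η s, ω.height ≤ 𝓔.H η + Γ)
    (hr : ∀ σ, 𝓔.H r ≤ 𝓔.H σ) (hrs : ∀ ω : 𝓔.Path r s, 𝓔.H r + Γ ≤ ω.height)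
    (hη : η ≠ r) (hQ : 0 < 𝓔.Q r η) (hHη : 𝓔.H η < 𝓔.H r + Γ) :
    𝓔.maxDepth (Set.univ \ {s}) = Γ := by
  obtain ⟨C, hC, hCΓ⟩ := exists_maximalCycle_le_depth hsymm hr ⟨(hs r).choose⟩ hrs hη hQ hHη
  have hle : ∀ x ∈ 𝓔.depth '' 𝓔.maximalCycles (Set.univ \ {s}), x ≤ Γ := by
    rintro _ ⟨D, hD, rfl⟩
    replace hD : Maximal (fun D => 𝓔.IsCycle D ∧ D ⊆ Set.univ \ {s}) D := hD
    exact depth_le hΓ hs hD.prop.1.1 fun h => (hD.prop.2 h).2 rfl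
  exact le_antisymm (csSup_le ⟨_, C, hC, rfl⟩ hle) (hCΓ.trans (le_csSup ⟨Γ, hle⟩ ⟨C, hC, rfl⟩))

end EnergyLandscape

namespace Potts

/-! ### Colour changes around a cycle -/

section CyclicChanges

variable {α : Type*} {n : ℕ} [NeZero n]

open scoped Classical in
/-- The number of places where a function on the cycle `Fin n` differs from its successor. -/
noncomputable def cyclicChanges (f : Fin n → α) : ℕ :=
  (Finset.univ.filter fun i => f i ≠ f (i + 1)).card

open scoped Fin.NatCast Fin.CommRing in
-- Walking on from `i₀ + 1` reaches every place without using the step out of `i₀`.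
theorem eq_of_forall_ne_step (f : Fin n → α) (i₀ : Fin n)
    (hf : ∀ i, i ≠ i₀ → f i = f (i + 1)) (i : Fin n) : f i = f (i₀ + 1) := by
  have key : ∀ k : ℕ, k < n → f (i₀ + 1 + (k : Fin n)) = f (i₀ + 1) := by
    intro k
    induction k with
    | zero => simp
    | succ k ih =>
      intro hk
      rw [← ih (by omega), hf (i₀ + 1 + (k : Fin n)), Nat.cast_succ, add_assoc (i₀ + 1)]
      intro h
      rw [add_assoc, add_eq_left] at h
      have h' : ((k + 1 : ℕ) : Fin n) = 0 := by rw [Nat.cast_succ, add_comm]; exact h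
      rw [Fin.natCast_eq_zero] at h'
      exact absurd (Nat.le_of_dvd (by omega) h') (by omega)
  have h := key (i - (i₀ + 1)).val (i - (i₀ + 1)).isLt
  rwa [Fin.cast_val_eq_self, add_sub_cancel] at h

theorem cyclicChanges_const (c : α) : cyclicChanges (fun _ : Fin n => c) = 0 := by
  simp [cyclicChanges]

theorem eq_of_cyclicChanges_eq_zero {f : Fin n → α} (h : cyclicChanges f = 0) (i j : Fin n) :
    f i = f j := by
  simp only [cyclicChanges, Finset.card_eq_zero, Finset.filter_eq_empty_iff, Finset.mem_univ,
    true_implies, not_not] at h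
  rw [eq_of_forall_ne_step f 0 (fun _ _ => @h _) i, eq_of_forall_ne_step f 0 (fun _ _ => @h _) j]

/-- A lone change is impossible: the rest of the cycle would force both its ends to agree. -/
theorem two_le_cyclicChanges {f : Fin n → α} {i j : Fin n} (h : f i ≠ f j) :
    2 ≤ cyclicChanges f := by
  have key : ∀ i₀, ∃ k, k ≠ i₀ ∧ f k ≠ f (k + 1) := by
    intro i₀
    by_contra! hcon
    exact h ((eq_of_forall_ne_step f i₀ hcon i).trans (eq_of_forall_ne_step f i₀ hcon j).symm)
  obtain ⟨a, -, ha⟩ := key 0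
  obtain ⟨b, hba, hb⟩ := key a
  exact Finset.one_lt_card.mpr ⟨a, by simpa using ha, b, by simpa using hb, hba.symm⟩

open scoped Classical in
-- Where the patched function changes, either `p` changes or both ends lie outside `p` and `f`
-- changes.
theorem cyclicChanges_ite_le (p : Fin n → Prop) (c : α) (f : Fin n → α) :
    cyclicChanges (fun i => if p i then c else f i) ≤ cyclicChanges f + cyclicChanges p := by
  unfold cyclicChanges
  refine (Finset.card_le_card ?_).trans (Finset.card_union_le _ _)
  intro i
  simp only [Finset.mem_filter, Finset.mem_univ, true_and, Finset.mem_union]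
  intro h
  by_cases h1 : p i <;> by_cases h2 : p (i + 1) <;> simp_all

theorem cyclicChanges_le_two {p : Fin n → Prop} (hp : ∀ i j, i ≤ j → p j → p i) :
    cyclicChanges p ≤ 2 := by
  classical
  have hsucc : ∀ i : Fin n, i.val + 1 < n → (i + 1).val = i.val + 1 := fun i hi =>
    Fin.val_add_one_of_lt' hi
  have hlast : ∀ i : Fin n, p i ≠ p (i + 1) → i.val + 1 < n → p i ∧ ¬ p (i + 1) := by
    intro i hi hin
    by_cases h : p (i + 1)
    · exact absurd (propext ⟨fun _ => h, fun _ => hp i (i + 1)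
        (by rw [Fin.le_def, hsucc i hin]; omega) h⟩) hi
    · exact ⟨by by_contra h'; exact hi (by simp [h, h']), h⟩
  have hn : 0 < n := Nat.pos_of_ne_zero (NeZero.ne n)
  -- One change may occur at the wrap-around from `n - 1` to `0`; elsewhere a decreasing predicate
  -- changes at most once.
  have hcard : ((Finset.univ.filter fun i => p i ≠ p (i + 1)).erase
      (⟨n - 1, by omega⟩ : Fin n)).card ≤ 1 := by
    refine Finset.card_le_one.mpr ?_
    have hne : ∀ i : Fin n, i ≠ ⟨n - 1, by omega⟩ → i.val + 1 < n := fun i hi => by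
      have h1 : i.val ≠ n - 1 := fun h => hi (Fin.ext h)
      have h2 := i.isLt
      omega
    have hle : ∀ i j : Fin n, i.val + 1 < n → p j → ¬ p (i + 1) → j ≤ i := by
      intro i j hi hj hi'
      by_contra! hij
      exact hi' (hp _ _ (by rw [Fin.le_def, hsucc i hi]; exact hij) hj)
    intro i hi j hj
    simp only [Finset.mem_erase, Finset.mem_filter, Finset.mem_univ, true_and] at hi hj
    have hi' := hlast i hi.2 (hne i hi.1)
    have hj' := hlast j hj.2 (hne j hj.1)
    exact le_antisymm (hle j i (hne j hj.1) hi'.1 hj'.2) (hle i j (hne i hi.1) hj'.1 hi'.2)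
  have := Finset.pred_card_le_card_erase (s := Finset.univ.filter fun i => p i ≠ p (i + 1))
    (a := (⟨n - 1, by omega⟩ : Fin n))
  unfold cyclicChanges
  convert (by omega : (Finset.univ.filter fun i => p i ≠ p (i + 1)).card ≤ 2)

end CyclicChanges

/-! ### Disagreements and perimeters on the discrete torus -/

section Grid

variable {α : Type*} {K L : ℕ}

/-- At least two of the rows and columns are constantly `c`. -/
def HasTwoLines (c : α) (f : Fin K → Fin L → α) : Prop :=
  (∃ i i', i ≠ i' ∧ (∀ j, f i j = c) ∧ ∀ j, f i' j = c) ∨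
  (∃ j j', j ≠ j' ∧ (∀ i, f i j = c) ∧ ∀ i, f i j' = c) ∨
  ∃ i j, (∀ j', f i j' = c) ∧ ∀ i', f i' j = c

theorem HasTwoLines.swap {c : α} {f : Fin K → Fin L → α} (h : HasTwoLines c fun j i => f i j) :
    HasTwoLines c f := by
  rcases h with h | h | ⟨i, j, h1, h2⟩
  · exact Or.inr (Or.inl h)
  · exact Or.inl h
  · exact Or.inr (Or.inr ⟨j, i, h2, h1⟩)

/-- Each row other than `i₀` contains `c`, at `j₀`, and another colour, so it changes at least
twice. -/
theorem le_sum_cyclicChanges_of_cross [NeZero L] {c : α} {f : Fin K → Fin L → α} {i₀ : Fin K} {j₀ : Fin L}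
    (hcol : ∀ i, f i j₀ = c) (h : ∀ i, i ≠ i₀ → ∃ j, f i j ≠ c) :
    2 * (K - 1) ≤ ∑ i, cyclicChanges (f i) := by
  have h1 := Finset.card_nsmul_le_sum (Finset.univ.erase i₀) (fun i => cyclicChanges (f i)) 2
    (fun i hi => by
      obtain ⟨j, hj⟩ := h i (Finset.ne_of_mem_erase hi)
      exact two_le_cyclicChanges (i := j) (j := j₀) (by rwa [hcol i]))
  rw [Finset.card_erase_of_mem (Finset.mem_univ _), Finset.card_univ, Fintype.card_fin,
    smul_eq_mul, mul_comm] at h1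
  exact h1.trans (Finset.sum_le_sum_of_subset (Finset.erase_subset _ _))

variable [NeZero K] [NeZero L]

/-- The number of disagreeing pairs of neighbours of a function on a discrete torus, where the
rows are `f i` and the columns are `fun i => f i j`. -/
noncomputable def gridChanges (f : Fin K → Fin L → α) : ℕ :=
  ∑ i, cyclicChanges (f i) + ∑ j, cyclicChanges fun i => f i j

theorem gridChanges_swap (f : Fin K → Fin L → α) :
    gridChanges (fun j i => f i j) = gridChanges f :=
  add_comm _ _

theorem gridChanges_const (c : α) : gridChanges (fun (_ : Fin K) (_ : Fin L) => c) = 0 := by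
  simp [gridChanges, cyclicChanges_const]

theorem eq_of_gridChanges_eq_zero {f : Fin K → Fin L → α} (h : gridChanges f = 0)
    (i i' : Fin K) (j j' : Fin L) : f i j = f i' j' := by
  simp only [gridChanges, Nat.add_eq_zero_iff, Finset.sum_eq_zero_iff, Finset.mem_univ,
    true_implies] at h
  exact (eq_of_cyclicChanges_eq_zero (h.1 i) j j').trans
    (eq_of_cyclicChanges_eq_zero (h.2 j') i i')

open scoped Classical in
theorem gridChanges_ite_le (p : Fin K → Fin L → Prop) (c : α) (f : Fin K → Fin L → α) :
    gridChanges (fun i j => if p i j then c else f i j) ≤ gridChanges f + gridChanges p := by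
  have h1 := Finset.sum_le_sum fun i (_ : i ∈ Finset.univ) => cyclicChanges_ite_le (p i) c (f i)
  have h2 := Finset.sum_le_sum fun j (_ : j ∈ Finset.univ) =>
    cyclicChanges_ite_le (fun i => p i j) c (fun i => f i j)
  rw [Finset.sum_add_distrib] at h1 h2
  exact (add_le_add h1 h2).trans_eq (add_add_add_comm _ _ _ _)

theorem sum_le_two_of_eq_zero {n : ℕ} (F : Fin n → ℕ) (k : ℕ) (h2 : ∀ i, F i ≤ 2)
    (h0 : ∀ i : Fin n, (i : ℕ) ≠ k → F i = 0) : ∑ i, F i ≤ 2 := by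
  by_cases hk : k < n
  · rw [Finset.sum_eq_single (⟨k, hk⟩ : Fin n) (fun i _ hi => h0 i fun h => hi (Fin.ext h))
      (by simp)]
    exact h2 _
  · rw [Finset.sum_eq_zero fun i _ => h0 i (by have := i.isLt; omega)]
    omega

/-- The perimeter of an initial segment in the lexicographic order. -/
theorem gridChanges_lex_le (n : ℕ) :
    gridChanges (fun (a : Fin K) (b : Fin L) => (b : ℕ) * K + a < n) ≤ 2 * K + 2 := by
  have hK : 0 < K := Nat.pos_of_ne_zero (NeZero.ne K)
  -- Each of the `K` lines in the long direction of the enumeration meets the segment in an initial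
  -- piece. Of the lines of length `K`, only number `n / K` can be partly filled.
  refine add_le_add ?_ (sum_le_two_of_eq_zero _ (n / K) ?_ ?_)
  · refine (Finset.sum_le_card_nsmul _ _ 2 ?_).trans (by simp [mul_comm])
    intro i _
    refine cyclicChanges_le_two fun j j' hj h => ?_
    have := Nat.mul_le_mul_right K (Fin.le_def.mp hj)
    omega
  · intro j
    refine cyclicChanges_le_two fun i i' hi h => ?_
    have := Fin.le_def.mp hi
    omega
  · intro j hj
    rcases Nat.lt_or_gt_of_ne hj with h | h
    · have h' : ((j : ℕ) + 1) * K ≤ n :=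
        (Nat.mul_le_mul_right K h).trans (Nat.div_mul_le_self n K)
      rw [← cyclicChanges_const (n := K) True]
      congr 1
      funext i
      have := i.isLt
      refine eq_true ?_
      rw [add_mul] at h'
      omega
    · have h' : n < (j : ℕ) * K := (Nat.div_lt_iff_lt_mul hK).mp h
      rw [← cyclicChanges_const (n := K) False]
      congr 1
      funext i
      refine eq_false ?_
      omega

/-- The perimeter of a single vertex. -/
theorem gridChanges_vertex_le :
    gridChanges (fun (a : Fin K) (b : Fin L) => a = 0 ∧ b = 0) ≤ 4 := by
  refine add_le_add (b := 2) (d := 2) (sum_le_two_of_eq_zero _ 0 ?_ ?_)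
    (sum_le_two_of_eq_zero _ 0 ?_ ?_)
  · exact fun i => cyclicChanges_le_two fun j j' hj h =>
      ⟨h.1, le_antisymm (hj.trans h.2.le) (Fin.le_def.mpr (by simp))⟩
  · intro i hi
    have : i ≠ 0 := fun h => hi (by simp [h])
    simp [this, cyclicChanges_const]
  · exact fun i => cyclicChanges_le_two fun j j' hj h =>
      ⟨le_antisymm (hj.trans h.1.le) (Fin.le_def.mpr (by simp)), h.2⟩
  · intro i hi
    have : i ≠ 0 := fun h => hi (by simp [h])
    simp [this, cyclicChanges_const]

/-- An enumeration of the vertices along the shorter side, whose initial segments have small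
perimeter. -/
theorem exists_enumeration (K L : ℕ) [NeZero K] [NeZero L] :
    ∃ e : Fin K → Fin L → ℕ, (∀ i j i' j', e i j = e i' j' → i = i' ∧ j = j') ∧
      (∀ i j, e i j < K * L) ∧ e 0 0 = 0 ∧
      ∀ n, gridChanges (fun i j => e i j < n) ≤ 2 * min K L + 2 := by
  have key : ∀ (A B : ℕ) (a a' : Fin A) (b b' : Fin B),
      ((b : ℕ) * A + a = b' * A + a' → a = a' ∧ b = b') ∧ (b : ℕ) * A + a < A * B := by
    intro A B a a' b b'
    have ha := a.isLt
    have ha' := a'.isLt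
    refine ⟨fun h => ?_, ?_⟩
    · have h1 := congrArg (· % A) h
      have h2 := congrArg (· / A) h
      simp only [mul_comm _ A, Nat.mul_add_mod, Nat.mod_eq_of_lt ha, Nat.mod_eq_of_lt ha',
        Nat.mul_add_div (by omega : 0 < A), Nat.div_eq_of_lt ha, Nat.div_eq_of_lt ha'] at h1 h2
      exact ⟨Fin.ext h1, Fin.ext (by simpa using h2)⟩
    · have := Nat.mul_le_mul_right A (Nat.succ_le_of_lt b.isLt)
      rw [Nat.succ_mul] at this
      rw [mul_comm A B]
      omega
  rcases le_total K L with h | h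
  · refine ⟨fun i j => j * K + i, fun i j i' j' => (key K L i i' j j').1,
      fun i j => (key K L i i j j).2, by simp, fun n => ?_⟩
    rw [min_eq_left h]
    exact gridChanges_lex_le n
  · refine ⟨fun i j => i * L + j, fun i j i' j' he => ((key L K j j' i i').1 he).symm,
      fun i j => mul_comm K L ▸ (key L K j j i i).2, by simp, fun n => ?_⟩
    rw [min_eq_right h, ← gridChanges_swap]
    exact gridChanges_lex_le n

/-- One of the two rows must contain the updated vertex. In `f` that row is `c` except there, which
gives two changes. Every column meets the other row in `c` but is not constantly `c`, or the two
would form a pair of lines; this gives `2 * L` more. -/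
theorem gridChanges_of_rows (hL : 2 ≤ L) {c : α} {f g : Fin K → Fin L → α} {a : Fin K} {b : Fin L}
    (hfg : ∀ i j, (i, j) ≠ (a, b) → f i j = g i j) (hf : ¬ HasTwoLines c f)
    {i i' : Fin K} (hii' : i ≠ i') (hi : ∀ j, g i j = c) (hi' : ∀ j, g i' j = c) :
    2 * L + 2 ≤ gridChanges f := by
  wlog hia : i = a generalizing i i'
  · by_cases hia' : i' = a
    · exact this hii'.symm hi' hi hia'
    · refine absurd (Or.inl ⟨i, i', hii', fun j => ?_, fun j => ?_⟩) hf
      · rw [hfg i j (by simp [hia]), hi]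
      · rw [hfg i' j (by simp [hia']), hi']
  subst hia
  have hi'f : ∀ j, f i' j = c := fun j => by rw [hfg i' j (by simp [hii'.symm]), hi']
  have hb : f i b ≠ c := by
    intro hb
    refine hf (Or.inl ⟨i, i', hii', fun j => ?_, hi'f⟩)
    by_cases hj : j = b
    · rw [hj, hb]
    · rw [hfg i j (by simp [hj]), hi]
  have : Nontrivial (Fin L) := Fin.nontrivial_iff_two_le.mpr hL
  obtain ⟨b', hb'⟩ := exists_ne b
  have hrow : 2 ≤ cyclicChanges (f i) :=
    two_le_cyclicChanges (i := b) (j := b') (by rwa [hfg i b' (by simp [hb']), hi])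
  have hcol : ∀ j, 2 ≤ cyclicChanges fun i => f i j := by
    intro j
    have : ∃ k, f k j ≠ c := by
      by_contra! hcon
      exact hf (Or.inr (Or.inr ⟨i', j, hi'f, hcon⟩))
    obtain ⟨k, hk⟩ := this
    exact two_le_cyclicChanges (i := k) (j := i') (by simpa only [hi'f j] using hk)
  have h1 := Finset.single_le_sum (f := fun i => cyclicChanges (f i)) (fun _ _ => Nat.zero_le _)
    (Finset.mem_univ i)
  have h2 := Finset.card_nsmul_le_sum Finset.univ (fun j => cyclicChanges fun i => f i j) 2
    (fun j _ => hcol j)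
  simp only [Finset.card_univ, Fintype.card_fin, smul_eq_mul] at h2
  unfold gridChanges
  omega

/-- A single-vertex update creating two lines of colour `c` involves a configuration with many
disagreements. -/
theorem le_gridChanges_of_update (hK : 3 ≤ K) (hL : 3 ≤ L) {c : α} {f g : Fin K → Fin L → α}
    {a : Fin K} {b : Fin L} (hfg : ∀ i j, (i, j) ≠ (a, b) → f i j = g i j)
    (hf : ¬ HasTwoLines c f) (hg : HasTwoLines c g) :
    2 * min K L + 2 ≤ gridChanges f ∨ 2 * min K L + 2 ≤ gridChanges g := by
  by_cases hrows : ∃ i i', i ≠ i' ∧ (∀ j, g i j = c) ∧ ∀ j, g i' j = c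
  · obtain ⟨i, i', hii', hi, hi'⟩ := hrows
    have := gridChanges_of_rows (by omega) hfg hf hii' hi hi'
    left
    omega
  by_cases hcols : ∃ j j', j ≠ j' ∧ (∀ i, g i j = c) ∧ ∀ i, g i j' = c
  · obtain ⟨j, j', hjj', hj, hj'⟩ := hcols
    have := gridChanges_of_rows (f := fun j i => f i j) (g := fun j i => g i j) (a := b) (b := a)
      (by omega) (fun j i h => hfg i j (by simpa [and_comm] using h)) (fun h => hf h.swap)
      hjj' hj hj'
    rw [gridChanges_swap] at this
    left
    omega
  -- There remains a cross with no further full line. It forces `2(K - 1) + 2(L - 1)` disagreements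
  -- in `g`, enough because `max K L ≥ 3`.
  obtain ⟨i₀, j₀, hi₀, hj₀⟩ := (hg.resolve_left hrows).resolve_left hcols
  have h1 := le_sum_cyclicChanges_of_cross (i₀ := i₀) hj₀ fun i hi => by
    by_contra! hcon
    exact hrows ⟨i, i₀, hi, hcon, hi₀⟩
  have h2 := le_sum_cyclicChanges_of_cross (f := fun j i => g i j) (i₀ := j₀) hi₀ fun j hj => by
    by_contra! hcon
    exact hcols ⟨j, j₀, hj, hcon, hj₀⟩
  right
  unfold gridChanges
  omega

end Grid

end Potts

/-! ### The energy in terms of disagreements and ones -/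

namespace Potts

theorem cycleGraph_adj_iff {n : ℕ} [NeZero n] (hn : 3 ≤ n) (u v : Fin n) :
    (SimpleGraph.cycleGraph n).Adj u v ↔ v = u + 1 ∨ u = v + 1 := by
  obtain ⟨k, rfl⟩ : ∃ k, n = k + 2 := ⟨n - 2, by omega⟩
  rw [SimpleGraph.cycleGraph_adj, sub_eq_iff_eq_add', sub_eq_iff_eq_add', or_comm]

theorem add_one_ne {n : ℕ} [NeZero n] (hn : 3 ≤ n) (u : Fin n) : u + 1 ≠ u := by
  intro h
  have := congrArg Fin.val h
  rw [Fin.val_add, Fin.val_one', Nat.mod_eq_of_lt (by omega : 1 < n)] at this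
  have hu := u.isLt
  rcases Nat.lt_or_ge (u.val + 1) n with h' | h'
  · rw [Nat.mod_eq_of_lt h'] at this; omega
  · rw [show u.val + 1 = n by omega, Nat.mod_self] at this; omega

theorem add_one_add_one_ne {n : ℕ} [NeZero n] (hn : 3 ≤ n) (u : Fin n) : u + 1 + 1 ≠ u := by
  obtain ⟨k, rfl⟩ : ∃ k, n = k + 3 := ⟨n - 3, by omega⟩
  intro h
  rw [add_assoc, add_eq_left] at h
  have := congrArg Fin.val h
  rw [Fin.val_add, Fin.val_one', Nat.mod_eq_of_lt (by omega : 1 < k + 3), Fin.val_zero,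
    Nat.mod_eq_of_lt (by omega)] at this
  omega

variable {K L q : ℕ}

section Energy

variable [NeZero K] [NeZero L]

/-- The edges of the torus, each as the step from a vertex to one of its two successors. -/
def edgeOfStep : Vertex K L ⊕ Vertex K L → Sym2 (Vertex K L)
  | .inl v => s(v, (v.1, v.2 + 1))
  | .inr v => s(v, (v.1 + 1, v.2))

/-- In a cycle of length `2` the two steps between its vertices would be the same edge; length at
least `3` excludes this. -/
theorem edgeOfStep_injective (hK : 3 ≤ K) (hL : 3 ≤ L) :
    Function.Injective (edgeOfStep (K := K) (L := L)) := by
  have a1 := add_one_ne hK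
  have a2 := add_one_ne hL
  have b1 := add_one_add_one_ne hK
  have b2 := add_one_add_one_ne hL
  rintro (⟨i, j⟩ | ⟨i, j⟩) (⟨i', j'⟩ | ⟨i', j'⟩) h <;>
    simp only [edgeOfStep, Sym2.eq_iff, Prod.mk.injEq] at h <;> grind

open scoped Classical in
theorem edgeFinset_torus (hK : 3 ≤ K) (hL : 3 ≤ L) :
    (torus K L).edgeFinset = Finset.univ.image edgeOfStep := by
  ext e
  induction e using Sym2.ind with
  | _ v w =>
    obtain ⟨i, j⟩ := v
    obtain ⟨i', j'⟩ := w
    rw [SimpleGraph.mem_edgeFinset, SimpleGraph.mem_edgeSet, torus]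
    simp only [SimpleGraph.boxProd_adj,
      cycleGraph_adj_iff hK, cycleGraph_adj_iff hL, Finset.mem_image, Finset.mem_univ, true_and,
      Sum.exists, edgeOfStep, Sym2.eq_iff, Prod.exists, Prod.mk.injEq]
    grind

/-- The number of vertices with spin `1`. -/
def numOnes (σ : Config K L q) : ℕ := (Finset.univ.filter fun u => (σ u : ℕ) = 1).card

/-- There are `2KL` edges, and each contributes `-1` unless its ends disagree. -/
theorem energyNeg_eq (hK : 3 ≤ K) (hL : 3 ≤ L) (h : ℝ) (σ : Config K L q) :
    energyNeg K L q h σ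
      = -(2 * K * L) + gridChanges (fun i j => σ (i, j)) + h * numOnes σ := by
  classical
  have h1 : ∀ (P : Prop) [Decidable P], (if P then (1 : ℝ) else 0) = 1 - if ¬ P then 1 else 0 := by
    intro P _
    by_cases hP : P <;> simp [hP]
  have h2 : ∀ v w : Vertex K L,
      (∀ x ∈ s(v, w), ∀ y ∈ s(v, w), σ x = σ y) ↔ σ v = σ w := by
    intro v w
    simp only [Sym2.mem_iff]
    grind
  have h3 : (∑ v : Vertex K L, if σ v ≠ σ (v.1, v.2 + 1) then (1 : ℝ) else 0)
      + (∑ v : Vertex K L, if σ v ≠ σ (v.1 + 1, v.2) then (1 : ℝ) else 0)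
      = gridChanges fun i j => σ (i, j) := by
    rw [Fintype.sum_prod_type, Fintype.sum_prod_type_right]
    simp only [gridChanges, cyclicChanges, Finset.card_filter]
    push_cast
    congr! 4
  have h4 : (∑ u : Vertex K L, if (σ u : ℕ) = 1 then (1 : ℝ) else 0) = numOnes σ := by
    simp [numOnes]
  unfold energyNeg
  rw [h4]
  congr 1
  have h5 : ∀ g : Sym2 (Vertex K L) → ℝ, ∑ e ∈ (torus K L).edgeFinset, g e
      = ∑ v, g (edgeOfStep (.inl v)) + ∑ v, g (edgeOfStep (.inr v)) := by
    intro g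
    have := edgeFinset_torus (K := K) (L := L) hK hL
    rw [← Fintype.sum_sum_type fun x => g (edgeOfStep x),
      ← Finset.sum_image fun a _ b _ hab => edgeOfStep_injective hK hL hab]
    congr!
  rw [h5]
  simp only [edgeOfStep, h2]
  rw [← h3]
  have h6 : ∀ w : Vertex K L → Vertex K L, (∑ v, if σ v = σ (w v) then (1 : ℝ) else 0)
      = K * L - ∑ v, if σ v ≠ σ (w v) then (1 : ℝ) else 0 := by
    intro w
    rw [Finset.sum_congr rfl fun v _ => h1 (σ v = σ (w v)), Finset.sum_sub_distrib]
    simp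
  rw [h6 fun v => (v.1, v.2 + 1), h6 fun v => (v.1 + 1, v.2)]
  ring

end Energy

/-! ### Single-spin updates -/

section Connectivity

theorem connectivity_pos_iff [NeZero K] [NeZero L] (hq : 0 < q) {σ σ' : Config K L q} :
    0 < connectivity K L q σ σ' ↔ numDiff σ σ' ≤ 1 := by
  have hq' : (0 : ℝ) < q := by exact_mod_cast hq
  have hV : (0 : ℝ) < Fintype.card (Vertex K L) := by exact_mod_cast Fintype.card_pos
  unfold connectivity
  split_ifs with h1 h0
  · simp only [h1, le_refl, iff_true]; positivity
  · simp only [h0, zero_le, iff_true]; positivity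
  · simp only [lt_irrefl, false_iff]; omega

theorem numDiff_comm (σ σ' : Config K L q) : numDiff σ σ' = numDiff σ' σ := by
  simp [numDiff, ne_comm]

theorem numDiff_le_one_of_forall {σ σ' : Config K L q} (v : Vertex K L)
    (h : ∀ w, w ≠ v → σ w = σ' w) : numDiff σ σ' ≤ 1 := by
  refine (Finset.card_le_card (t := {v}) ?_).trans (by simp)
  intro w hw
  rw [Finset.mem_singleton]
  by_contra hwv
  exact (Finset.mem_filter.mp hw).2 (h w hwv)

theorem exists_forall_of_numDiff_le_one [NeZero K] [NeZero L] {σ σ' : Config K L q}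
    (h : numDiff σ σ' ≤ 1) : ∃ v, ∀ w, w ≠ v → σ w = σ' w := by
  by_cases hne : ∃ v, σ v ≠ σ' v
  · obtain ⟨v, hv⟩ := hne
    refine ⟨v, fun w hw => ?_⟩
    by_contra hw'
    exact hw (Finset.card_le_one.mp h w (by simpa using hw') v (by simpa using hv))
  · push Not at hne
    exact ⟨(0, 0), fun w _ => hne w⟩

end Connectivity

/-! ### Stable states and energy barriers of the Potts landscape -/

section Landscape

variable {h : ℝ}

theorem numOnes_const {c : Spin q} (hc : (c : ℕ) ≠ 1) :
    numOnes (K := K) (L := L) (fun _ => c) = 0 := by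
  simp [numOnes, hc]

theorem numOnes_allOne (hq : 2 < q) : numOnes (allOne K L q hq) = K * L := by
  simp [numOnes, allOne]

variable [NeZero K] [NeZero L]

theorem energy_const (hK : 3 ≤ K) (hL : 3 ≤ L) {c : Spin q} (hc : (c : ℕ) ≠ 1) :
    (pottsNeg K L q h).H (fun _ => c) = -(2 * K * L) := by
  simp [pottsNeg, energyNeg_eq hK hL, numOnes_const hc, gridChanges_const]

theorem mem_stable_iff (hK : 3 ≤ K) (hL : 3 ≤ L) (hq : 2 < q) (h_pos : 0 < h)
    {σ : Config K L q} :
    σ ∈ (pottsNeg K L q h).stable ↔ ∃ c : Spin q, (c : ℕ) ≠ 1 ∧ σ = fun _ => c := by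
  constructor
  · intro hσ
    have h1 := hσ.2 (fun _ => ⟨2, by simp; omega⟩) trivial
    rw [energy_const hK hL (by simp)] at h1
    simp only [pottsNeg, energyNeg_eq hK hL] at h1
    have h2 : (0 : ℝ) ≤ gridChanges (fun i j => σ (i, j)) := Nat.cast_nonneg _
    have h3 : (0 : ℝ) ≤ h * numOnes σ := by positivity
    have h4 : gridChanges (fun i j => σ (i, j)) = 0 := by
      have : (gridChanges (fun i j => σ (i, j)) : ℝ) = 0 := by linarith
      exact_mod_cast this
    have h5 : numOnes σ = 0 := by
      have : h * numOnes σ = 0 := by linarith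
      simpa [h_pos.ne'] using this
    have hconst : σ = fun _ => σ (0, 0) := by
      funext v
      exact eq_of_gridChanges_eq_zero h4 v.1 0 v.2 0
    refine ⟨σ (0, 0), fun hc => ?_, hconst⟩
    exact Finset.eq_empty_iff_forall_notMem.mp (Finset.card_eq_zero.mp h5) (0, 0) (by simpa using hc)
  · rintro ⟨c, hc, rfl⟩
    refine ⟨trivial, fun σ _ => ?_⟩
    rw [energy_const hK hL hc]
    simp only [pottsNeg, energyNeg_eq hK hL]
    have h3 : (0 : ℝ) ≤ h * numOnes σ := by positivity
    have h2 : (0 : ℝ) ≤ gridChanges (fun i j => σ (i, j)) := Nat.cast_nonneg _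
    linarith

open scoped Classical in
/-- Sweeping the torus line by line with the spin `c` leads from `η` to the constant
configuration along configurations with at most `2 min{K, L} + 2` new disagreements. -/
theorem exists_sweep_path (hq : 0 < q) (c : Spin q) (η : Config K L q) :
    ∃ ω : (pottsNeg K L q h).Path η fun _ => c, ∀ k, ∃ p : Fin K → Fin L → Prop,
      ω.toFun k = (fun v => if p v.1 v.2 then c else η v) ∧
      gridChanges p ≤ 2 * min K L + 2 ∧ (p 0 0 ∨ ω.toFun k = η) := by
  obtain ⟨e, hinj, hlt, h00, hper⟩ := exists_enumeration K L
  refine ⟨⟨K * L, fun k v => if e v.1 v.2 < k then c else η v, ?_, ?_, ?_⟩, ?_⟩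
  · simp
  · funext v
    simp [hlt]
  · intro k
    refine (connectivity_pos_iff hq).mpr ?_
    by_cases hk : ∃ v : Vertex K L, e v.1 v.2 = k
    · obtain ⟨v, hv⟩ := hk
      refine numDiff_le_one_of_forall v fun w hw => ?_
      have : e w.1 w.2 ≠ k := fun h => hw (by
        obtain ⟨h1, h2⟩ := hinj _ _ _ _ (h.trans hv.symm)
        exact Prod.ext h1 h2)
      have : e w.1 w.2 < k.castSucc.val ↔ e w.1 w.2 < k.succ.val := by simp; omega
      simp only [this]
    -- Surjectivity of the enumeration is not needed: if no vertex has number `k`, the path rests,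
    -- which the positive diagonal of the connectivity matrix allows.
    · push Not at hk
      refine numDiff_le_one_of_forall (0, 0) fun w _ => ?_
      have := hk w
      have : e w.1 w.2 < k.castSucc.val ↔ e w.1 w.2 < k.succ.val := by simp; omega
      simp only [this]
  · intro k
    refine ⟨fun i j => e i j < k, by funext v; dsimp only; congr, hper k, ?_⟩
    rcases Nat.eq_zero_or_pos k.val with hk | hk
    · exact Or.inr (by simp [hk])
    · exact Or.inl (h00.trans_lt hk)

open scoped Classical in
theorem energy_ite_le (hK : 3 ≤ K) (hL : 3 ≤ L) (h_pos : 0 < h) {c : Spin q} (hc : (c : ℕ) ≠ 1)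
    (η : Config K L q) (p : Fin K → Fin L → Prop) :
    (pottsNeg K L q h).H (fun v => if p v.1 v.2 then c else η v)
      ≤ (pottsNeg K L q h).H η + gridChanges p := by
  have h1 : (gridChanges (fun i j => if p i j then c else η (i, j)) : ℝ)
      ≤ gridChanges (fun i j => η (i, j)) + gridChanges p := by
    exact_mod_cast gridChanges_ite_le p c fun i j => η (i, j)
  have h2 : numOnes (fun v => if p v.1 v.2 then c else η v) ≤ numOnes η := by
    refine Finset.card_le_card fun v => ?_
    simp only [Finset.mem_filter, Finset.mem_univ, true_and]
    split_ifs
    · exact fun h => absurd h hc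
    · exact id
  have h3 : h * numOnes (fun v => if p v.1 v.2 then c else η v) ≤ h * numOnes η := by
    gcongr
  simp only [pottsNeg, energyNeg_eq hK hL]
  linarith

theorem exists_path_height_le (hK : 3 ≤ K) (hL : 3 ≤ L) (hq : 0 < q) (h_pos : 0 < h) {c : Spin q}
    (hc : (c : ℕ) ≠ 1) (η : Config K L q) :
    ∃ ω : (pottsNeg K L q h).Path η fun _ => c,
      ω.height ≤ (pottsNeg K L q h).H η + (2 * min (K : ℝ) L + 2) := by
  classical
  obtain ⟨ω, hω⟩ := exists_sweep_path (h := h) hq c η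
  refine ⟨ω, EnergyLandscape.Path.height_le_iff.mpr fun k => ?_⟩
  obtain ⟨p, hp, hper, -⟩ := hω k
  have h1 : (gridChanges p : ℝ) ≤ 2 * min (K : ℝ) L + 2 := by exact_mod_cast hper
  rw [hp]
  linarith [energy_ite_le hK hL h_pos hc η p]

/-- All ones has no disagreements, so the sweep shows at most the perimeter. Once the corner is
recoloured, the lost ones make the bound strict; before that the path is still at its start. -/
theorem exists_path_allOne_height_lt (hK : 3 ≤ K) (hL : 3 ≤ L) (hq : 2 < q) (h_pos : 0 < h)
    {c : Spin q} (hc : (c : ℕ) ≠ 1) :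
    ∃ ω : (pottsNeg K L q h).Path (allOne K L q hq) fun _ => c,
      ω.height < (pottsNeg K L q h).H (allOne K L q hq) + (2 * min (K : ℝ) L + 2) := by
  classical
  obtain ⟨ω, hω⟩ := exists_sweep_path (h := h) (by omega) c (allOne K L q hq)
  refine ⟨ω, EnergyLandscape.Path.height_lt_iff.mpr fun k => ?_⟩
  obtain ⟨p, hp, hper, h00 | h00⟩ := hω k
  · have h1 : (gridChanges p : ℝ) ≤ 2 * min (K : ℝ) L + 2 := by exact_mod_cast hper
    have h2 : (gridChanges (fun i j => ω.toFun k (i, j)) : ℝ) ≤ gridChanges p := by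
      have := gridChanges_ite_le p c fun i j => allOne K L q hq (i, j)
      have h0 : gridChanges (fun i j => allOne K L q hq (i, j)) = 0 := gridChanges_const _
      rw [h0, zero_add] at this
      rw [hp]
      exact_mod_cast this
    have h3 : numOnes (ω.toFun k) < numOnes (allOne K L q hq) := by
      refine Finset.card_lt_card ⟨fun v _ => by simp [allOne], fun hsub => ?_⟩
      have := hsub (show ((0, 0) : Vertex K L) ∈ _ by simp [allOne])
      simp [hp, h00, hc] at this
    have h4 : h * numOnes (ω.toFun k) < h * numOnes (allOne K L q hq) := by gcongr
    simp only [pottsNeg, energyNeg_eq hK hL]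
    have h0 : (0 : ℝ) ≤ gridChanges (fun i j => allOne K L q hq (i, j)) := Nat.cast_nonneg _
    linarith
  · rw [h00]
    have : (0 : ℝ) < 2 * min (K : ℝ) L + 2 := by positivity
    linarith

/-- Every path between two different constant configurations without spin `1` at its start
has to climb `2 min{K, L} + 2`. -/
theorem le_height_of_const_path (hK : 3 ≤ K) (hL : 3 ≤ L) (hq : 0 < q) (h_pos : 0 < h)
    {c d : Spin q} (hc : (c : ℕ) ≠ 1) (hcd : c ≠ d)
    (ω : (pottsNeg K L q h).Path (fun _ => c) fun _ => d) :
    (pottsNeg K L q h).H (fun _ => c) + (2 * min (K : ℝ) L + 2) ≤ ω.height := by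
  have key : ∃ k, 2 * min K L + 2 ≤ gridChanges fun i j => ω.toFun k (i, j) := by
    -- The start contains no line of colour `d` at all, while the end consists of such lines.
    obtain ⟨k, hk, hk'⟩ := ω.exists_crossing (fun σ => ¬ HasTwoLines d fun i j => σ (i, j))
      (by
        rintro (⟨i, _, _, h, _⟩ | ⟨j, _, _, h, _⟩ | ⟨i, j, h, _⟩)
        · exact hcd (h 0)
        · exact hcd (h 0)
        · exact hcd (h 0))
      (not_not.mpr (Or.inr (Or.inr ⟨0, 0, fun _ => rfl, fun _ => rfl⟩)))
    obtain ⟨v, hv⟩ := exists_forall_of_numDiff_le_one ((connectivity_pos_iff hq).mp (ω.step k))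
    rcases le_gridChanges_of_update hK hL (a := v.1) (b := v.2) (fun i j hij => hv (i, j) hij) hk
      (not_not.mp hk') with h | h
    · exact ⟨_, h⟩
    · exact ⟨_, h⟩
  obtain ⟨k, hk⟩ := key
  refine le_trans ?_ (ω.le_height k)
  rw [energy_const hK hL hc]
  simp only [pottsNeg, energyNeg_eq hK hL]
  have h1 : 2 * min (K : ℝ) L + 2 ≤ gridChanges fun i j => ω.toFun k (i, j) := by
    exact_mod_cast hk
  have h3 : (0 : ℝ) ≤ h * numOnes (ω.toFun k) := by positivity
  linarith

/-- With `q > 2` there are two spins besides `1`, hence a second stable state. -/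
theorem exists_other_spin (hq : 2 < q) (c : Spin q) : ∃ d : Spin q, (d : ℕ) ≠ 1 ∧ c ≠ d := by
  by_cases hc : (c : ℕ) = 2
  · exact ⟨⟨3, by simp; omega⟩, by simp, fun h => by simp [h] at hc⟩
  · exact ⟨⟨2, by simp; omega⟩, by simp, fun h => by simp [h] at hc⟩

theorem commHeightSet_stable (hK : 3 ≤ K) (hL : 3 ≤ L) (hq : 2 < q) (h_pos : 0 < h)
    {s : Config K L q} (hs : s ∈ (pottsNeg K L q h).stable) :
    (pottsNeg K L q h).commHeightSet {s} ((pottsNeg K L q h).stable \ {s})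
      = (pottsNeg K L q h).H s + (2 * min (K : ℝ) L + 2) := by
  obtain ⟨c, hc, rfl⟩ := (mem_stable_iff hK hL hq h_pos).mp hs
  obtain ⟨d, hd, hcd⟩ := exists_other_spin hq c
  have hmem : (fun _ => d) ∈ (pottsNeg K L q h).stable \ {fun _ => c} :=
    ⟨(mem_stable_iff hK hL hq h_pos).mpr ⟨d, hd, rfl⟩, fun h => hcd (congrFun h (0, 0)).symm⟩
  refine le_antisymm ?_ (EnergyLandscape.le_commHeightSet_singleton ⟨_, hmem⟩ ?_)
  · obtain ⟨ω, hω⟩ := exists_path_height_le hK hL (by omega) h_pos hd (fun _ => c)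
    exact ((EnergyLandscape.commHeightSet_singleton_le hmem).trans
      (EnergyLandscape.commHeight_le_height ω)).trans hω
  · rintro σ ⟨hσ, hne⟩
    obtain ⟨b, hb, rfl⟩ := (mem_stable_iff hK hL hq h_pos).mp hσ
    exact EnergyLandscape.le_commHeight
      ⟨(exists_path_height_le hK hL (by omega) h_pos hb (fun _ => c)).choose⟩
      (le_height_of_const_path hK hL (by omega) h_pos hc fun h => hne (by simp [h]))

theorem maxDepth_compl_stable (hK : 3 ≤ K) (hL : 3 ≤ L) (hq : 2 < q) (h_pos : 0 < h)
    {s : Config K L q} (hs : s ∈ (pottsNeg K L q h).stable) :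
    (pottsNeg K L q h).maxDepth (Set.univ \ {s}) = 2 * min (K : ℝ) L + 2 := by
  classical
  obtain ⟨c, hc, rfl⟩ := (mem_stable_iff hK hL hq h_pos).mp hs
  obtain ⟨d, hd, hcd⟩ := exists_other_spin hq c
  have hmin : (3 : ℝ) ≤ min (K : ℝ) L := le_min (by exact_mod_cast hK) (by exact_mod_cast hL)
  -- The neighbour `η` of the constant `d` has one flipped vertex; it costs at most `4`, below `2
  -- min{K, L} + 2 ≥ 8`.
  refine EnergyLandscape.maxDepth_compl_singleton_eq (r := fun _ => d)
    (η := fun v => if v.1 = 0 ∧ v.2 = 0 then c else d) ?_ (by linarith)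
    (exists_path_height_le hK hL (by omega) h_pos hc) ?_
    (le_height_of_const_path hK hL (by omega) h_pos hd hcd.symm) ?_ ?_ ?_
  · intro a b hab
    exact (connectivity_pos_iff (by omega)).mpr
      (numDiff_comm b a ▸ (connectivity_pos_iff (by omega)).mp hab)
  · exact fun σ => ((mem_stable_iff hK hL hq h_pos).mpr ⟨d, hd, rfl⟩).2 σ trivial
  · intro h
    exact hcd (by simpa using congrFun h (0, 0))
  · refine (connectivity_pos_iff (by omega)).mpr (numDiff_le_one_of_forall (0, 0) fun w hw => ?_)
    rw [if_neg fun h => hw (Prod.ext h.1 h.2)]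
  · have h1 := energy_ite_le hK hL h_pos hc (fun _ => d) (fun a b => a = 0 ∧ b = 0)
    have h2 : (gridChanges (fun (a : Fin K) (b : Fin L) => a = 0 ∧ b = 0) : ℝ) ≤ 4 := by
      exact_mod_cast gridChanges_vertex_le
    have h3 : (pottsNeg K L q h).H (fun v => if v.1 = 0 ∧ v.2 = 0 then c else d)
        ≤ (pottsNeg K L q h).H (fun _ => d)
          + gridChanges (fun (a : Fin K) (b : Fin L) => a = 0 ∧ b = 0) := by
      convert h1 using 4
    refine lt_of_le_of_lt h3 ?_
    linarith

/-- The energy of the starting point alone suffices: `hℓ* ≥ 2` and `min{K, L} ≥ 3ℓ*` give `h min{K,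
L} ≥ 6`, hence `hKL ≥ 6 min{K, L}`. -/
theorem lt_commHeightSet_allOne (hK : 3 ≤ K) (hL : 3 ≤ L) (hq : 2 < q) (h_pos : 0 < h)
    (h_size : 3 * criticalLength h ≤ min K L) :
    -(2 * K * L) + (2 * min (K : ℝ) L + 2)
      < (pottsNeg K L q h).commHeightSet {allOne K L q hq} (pottsNeg K L q h).stable := by
  obtain ⟨c, hc, -⟩ := exists_other_spin hq ⟨1, by simp; omega⟩
  have hmem := (mem_stable_iff (K := K) (L := L) hK hL hq h_pos).mpr ⟨c, hc, rfl⟩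
  have h1 : (pottsNeg K L q h).H (allOne K L q hq)
      ≤ (pottsNeg K L q h).commHeightSet {allOne K L q hq} (pottsNeg K L q h).stable := by
    refine EnergyLandscape.le_commHeightSet_singleton ⟨_, hmem⟩ fun σ hσ => ?_
    obtain ⟨b, hb, rfl⟩ := (mem_stable_iff hK hL hq h_pos).mp hσ
    exact EnergyLandscape.le_commHeight
      ⟨(exists_path_height_le hK hL (by omega) h_pos hb _).choose⟩ fun ω => ω.source_le_height
  refine lt_of_lt_of_le ?_ h1
  have h0 : gridChanges (fun i j => allOne K L q hq (i, j)) = 0 := gridChanges_const _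
  simp only [pottsNeg, energyNeg_eq hK hL, numOnes_allOne, h0]
  have h2 : 2 / h ≤ criticalLength h := Nat.le_ceil _
  have h3 : 3 * (criticalLength h : ℝ) ≤ min (K : ℝ) L := by exact_mod_cast h_size
  have h4 : 2 ≤ h * criticalLength h := by
    rw [div_le_iff₀ h_pos] at h2
    linarith
  have hm : (3 : ℝ) ≤ min (K : ℝ) L := le_min (by exact_mod_cast hK) (by exact_mod_cast hL)
  have h5 : min (K : ℝ) L * min (K : ℝ) L ≤ K * L :=
    mul_le_mul (min_le_left _ _) (min_le_right _ _) (by linarith) (by positivity)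
  have h6 : 6 ≤ h * min (K : ℝ) L := by nlinarith
  have h7 : 6 * min (K : ℝ) L ≤ h * (K * L) := by
    calc 6 * min (K : ℝ) L ≤ h * min (K : ℝ) L * min (K : ℝ) L := by gcongr
      _ = h * (min (K : ℝ) L * min (K : ℝ) L) := by ring
      _ ≤ h * (K * L) := by gcongr
  push_cast
  linarith

theorem barrier_allOne_lt (hK : 3 ≤ K) (hL : 3 ≤ L) (hq : 2 < q) (h_pos : 0 < h) :
    (pottsNeg K L q h).barrier (allOne K L q hq) (pottsNeg K L q h).stable
      < 2 * min (K : ℝ) L + 2 := by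
  obtain ⟨c, hc, -⟩ := exists_other_spin hq ⟨1, by simp; omega⟩
  obtain ⟨ω, hω⟩ := exists_path_allOne_height_lt hK hL hq h_pos hc
  have h1 := EnergyLandscape.commHeightSet_singleton_le (𝓔 := pottsNeg K L q h) (σ := allOne K L q hq)
    ((mem_stable_iff (K := K) (L := L) hK hL hq h_pos).mpr ⟨c, hc, rfl⟩)
  have h2 := EnergyLandscape.commHeight_le_height ω
  unfold EnergyLandscape.barrier
  linarith

end Landscape

end Potts

theorem theorem4p6 (K L q : ℕ) (h : ℝ)
    (hq : 2 < q)
    (h_pos : 0 < h) (h_lt_one : h < 1)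
    (h_not_int : ∀ n : ℤ, 2 / h ≠ (n : ℝ))
    (h_size : 3 * Potts.criticalLength h ≤ min K L)
    (s : Potts.Config K L q) (hs : s ∈ (Potts.pottsNeg K L q h).stable) :
    (Potts.pottsNeg K L q h).commHeightSet {s} ((Potts.pottsNeg K L q h).stable \ {s})
        < (Potts.pottsNeg K L q h).commHeightSet {Potts.allOne K L q hq}
            (Potts.pottsNeg K L q h).stable
    ∧ (Potts.pottsNeg K L q h).barrier (Potts.allOne K L q hq) (Potts.pottsNeg K L q h).stable
        < (Potts.pottsNeg K L q h).barrier s ((Potts.pottsNeg K L q h).stable \ {s})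
    ∧ (Potts.pottsNeg K L q h).barrier s ((Potts.pottsNeg K L q h).stable \ {s})
        = 2 * min (K : ℝ) (L : ℝ) + 2
    ∧ ∀ r ∈ (Potts.pottsNeg K L q h).stable,
        (Potts.pottsNeg K L q h).maxDepth (Set.univ \ {s})
          = (Potts.pottsNeg K L q h).barrier r ((Potts.pottsNeg K L q h).stable \ {r}) := by
  -- `ℓ* ≥ 1` turns the size hypothesis into `K, L ≥ 3`.
  have hcrit : 0 < Potts.criticalLength h := Nat.ceil_pos.mpr (by positivity)
  have hK : 3 ≤ K := by omega
  have hL : 3 ≤ L := by omega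
  have : NeZero K := ⟨by omega⟩
  have : NeZero L := ⟨by omega⟩
  have hbar : ∀ r ∈ (Potts.pottsNeg K L q h).stable,
      (Potts.pottsNeg K L q h).barrier r ((Potts.pottsNeg K L q h).stable \ {r})
        = 2 * min (K : ℝ) (L : ℝ) + 2 := by
    intro r hr
    rw [EnergyLandscape.barrier, Potts.commHeightSet_stable hK hL hq h_pos hr]
    ring
  refine ⟨?_, ?_, hbar s hs, fun r hr => ?_⟩
  · rw [Potts.commHeightSet_stable hK hL hq h_pos hs]
    obtain ⟨c, hc, rfl⟩ := (Potts.mem_stable_iff hK hL hq h_pos).mp hs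
    rw [Potts.energy_const hK hL hc]
    exact Potts.lt_commHeightSet_allOne hK hL hq h_pos h_size
  · rw [hbar s hs]
    exact Potts.barrier_allOne_lt hK hL hq h_pos
  · rw [hbar r hr, Potts.maxDepth_compl_stable hK hL hq h_pos hs]
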